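/- A ribbon graph $G=(V,E)$ is a surface with boundary that is the union of a finite set $V$ of vertex discs and a finite set $E$ of edge discs, such that the vertices and edges intersect in disjoint line segments, each segment lies on the boundary of exactly one vertex and exactly one edge, and each edge contains exactly two segments; ribbon graphs are considered up to homeomorphisms preserving this structure. (Ribbon graphs may be disconnected, non-orientable, and have loops, multiple edges and isolated vertices.) A ribbon subgraph of $G$ is a ribbon graph obtained from $G$ by removing vertices and edges, the edges at a removed vertex being removed as well. Write $k(H)$ for the number of connected components and $f(H)$ for the number of boundary components of a ribbon graph $H$, and for $A\subseteq E$ let $f(A)=f(V,A)$, where $(V,A)$ is the spanning ribbon subgraph with edge set $A$. The subgraph $(V,A)$ is a spanning quasi-tree of $G$ if $k(V,A)=k(G)$ and each connected component of $(V,A)$ has exactly one boundary component. A set system $(E,\mathcal F)$ is a set $E$ with a collection $\mathcal F$ of subsets of $E$. Let $D(G)=(E,\mathcal F(G))$, where $\mathcal F(G)$ is the collection of edge sets of spanning quasi-trees of $G$, and for an integer $n\ge 0$ let $$D_{\le n}(G)=\bigl(E,\{A\subseteq E\mid f(A)\le k(G)+n\}\bigr),\qquad D_{n}(G)=\bigl(E,\{A\subseteq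 E\mid f(A)= k(G)+n\}\bigr).$$ For a set system $D=(E,\mathcal F)$ and an integer $n$, let $\mathcal F_{\le n}=\{F\bigtriangleup A\mid F\in\mathcal F,\ A\subseteq E,\ |A|\le n\}$ (so $\mathcal F_{\le -1}=\emptyset$). For $n\ge 0$ the $n$-spread of $D$ is $(E,\mathcal F_{\le n})$, and, provided that $\mathcal F_{\bigtriangleup n}:=\mathcal F_{\le n}\setminus\mathcal F_{\le n-1}$ is non-empty, the $n$-toggle of $D$ is $(E,\mathcal F_{\bigtriangleup n})$. **Theorem.** Let $G=(V,E)$ be a ribbon graph and $n\geq 0$ an integer. Then 1. $D_{\le n}(G)$ is the $n$-spread of $D(G)$; 2. if $G$ has a ribbon subgraph (spanning or not) with $n+k(G)$ boundary components, then the $n$-toggle of $D(G)$ is defined, that is, $\mathcal F(G)_{\bigtriangleup n}\neq\emptyset$, and $D_n(G)$ is equal to it. -/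

import Mathlib

open scoped symmDiff

/-! ### Set systems, spreads and toggles -/

/-- A set system with ground set `E`: a collection of feasible subsets of `E`. -/
@[ext] structure SetSystem (E : Type*) where
  feasible : Set (Set E)

namespace SetSystem

variable {E : Type*}

/-- The `n`-spread: feasible sets are `F ∆ A` with `F` feasible and `|A| ≤ n`.
The index is an integer, so that the spread of index `-1` has no feasible sets. -/
def spread (D : SetSystem E) (n : ℤ) : SetSystem E where
  feasible := {X | ∃ F ∈ D.feasible, ∃ A : Set E, (A.ncard : ℤ) ≤ n ∧ X = F ∆ A}

/-- The `n`-toggle: the feasible sets of the `n`-spread that are not feasible in the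
`(n - 1)`-spread. -/
def toggle (D : SetSystem E) (n : ℤ) : SetSystem E where
  feasible := (D.spread n).feasible \ (D.spread (n - 1)).feasible

end SetSystem

/-! ### Ribbon graphs -/

/-- A ribbon graph with vertex discs `V` and edge discs `E`, given by a signed rotation system
after choosing an orientation of every vertex disc.

The pair `(e, i) : E × Bool` is one of the two line segments (half-edges) in which the edge disc
`e` meets the vertex discs; `vert (e, i)` is the vertex disc on whose boundary it lies. Going
around the boundary of a vertex disc in its chosen direction, the segment met after `h` is
`rot h`; thus the segments on one vertex disc form exactly one cycle of `rot`. The edge disc `e`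
respects the chosen orientations of the discs at its ends if `twisted e = false`, and reverses
them if `twisted e = true`. Loops, multiple edges, isolated vertices, several connected
components and non-orientable ribbon graphs are all allowed. -/
structure RibbonGraph (V E : Type*) where
  vert : E × Bool → V
  rot : Equiv.Perm (E × Bool)
  twisted : E → Bool
  vert_eq_iff : ∀ h h', vert h = vert h' ↔ rot.SameCycle h h'

namespace RibbonGraph

variable {V E : Type*}

/-- A ribbon subgraph: what remains after removing vertices and edges, where the edges at a
removed vertex are removed too. -/
structure Subgraph (G : RibbonGraph V E) where
  verts : Set V
  edges : Set E
  vert_mem : ∀ e ∈ edges, ∀ i, G.vert (e, i) ∈ verts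

/-- The spanning ribbon subgraph `(V, A)`. -/
def spanning (G : RibbonGraph V E) (A : Set E) : G.Subgraph where
  verts := Set.univ
  edges := A
  vert_mem := fun _ _ _ => Set.mem_univ _

namespace Subgraph

variable {G : RibbonGraph V E}

/-- The connected components of a ribbon subgraph: classes of its vertices under the equivalence
relation generated by adjacency through its edges. -/
def Component (H : G.Subgraph) : Type _ :=
  Quot (fun u v : H.verts => ∃ e ∈ H.edges, ∃ i, G.vert (e, i) = u ∧ G.vert (e, !i) = v)

/-- The number of connected components. -/
noncomputable def k (H : G.Subgraph) : ℕ := Nat.card H.Component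

/-- One step along the boundary of the surface `H`.

The corners of the edge discs of `G` are the ends of the line segments: `(h, false)` and
`(h, true)` are the first and the last point of the segment `h`, in the chosen direction of the
vertex disc on which `h` lies. They cut the boundary of `H` into the following pieces, and
each piece joins two corners. -/
inductive BoundaryStep (H : G.Subgraph) : (E × Bool) × Bool → (E × Bool) × Bool → Prop
  /-- The arc of the boundary of a vertex disc from the end of a segment to the start of the
  next one. -/
  | arc (h : E × Bool) : BoundaryStep H (h, true) (G.rot h, false)
  /-- If the edge is not in `H`, its segments are part of the boundary. -/
  | segment (h : E × Bool) (he : h.1 ∉ H.edges) : BoundaryStep H (h, false) (h, true)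
  /-- If the edge is in `H`, its two sides are part of the boundary. A side of an untwisted edge
  joins the last point of one of the two segments to the first point of the other; a side of a
  twisted edge joins the first points or the last points. -/
  | side (e : E) (i s : Bool) (he : e ∈ H.edges) :
      BoundaryStep H ((e, i), s) ((e, !i), if G.twisted e then s else !s)

/-- The corners that lie on vertex discs of `H`. -/
def Corner (H : G.Subgraph) : Type _ :=
  {c : (E × Bool) × Bool // G.vert c.1 ∈ H.verts}

/-- The number of boundary components: closed curves through the corners on the vertex discs of
`H`, and the boundary circles of the vertex discs of `H` that carry no corner at all because
the vertex is isolated in `G`. -/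
noncomputable def f (H : G.Subgraph) : ℕ :=
  Nat.card (Quot (fun c d : H.Corner => H.BoundaryStep c.1 d.1)) +
    Nat.card {v : V // v ∈ H.verts ∧ ∀ h, G.vert h ≠ v}

/-- A connected component, as a ribbon subgraph. -/
def component (H : G.Subgraph) (C : H.Component) : G.Subgraph where
  verts := {v | ∃ hv : v ∈ H.verts, (Quot.mk _ ⟨v, hv⟩ : H.Component) = C}
  edges := {e | ∃ he : e ∈ H.edges,
    (Quot.mk _ ⟨G.vert (e, false), H.vert_mem e he false⟩ : H.Component) = C}
  vert_mem := by
    rintro e ⟨he, hC⟩ i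
    refine ⟨H.vert_mem e he i, ?_⟩
    cases i
    · exact hC
    · exact Eq.trans (Quot.sound ⟨e, he, true, rfl, rfl⟩) hC

end Subgraph

/-- The number of connected components of `G`. -/
noncomputable def k (G : RibbonGraph V E) : ℕ := (G.spanning Set.univ).k

/-- `A` is the edge set of a spanning quasi-tree of `G`: the spanning ribbon subgraph `(V, A)`
has as many connected components as `G`, and each of them has exactly one boundary component. -/
def IsSpanningQuasiTree (G : RibbonGraph V E) (A : Set E) : Prop :=
  (G.spanning A).k = G.k ∧
    ∀ C : (G.spanning A).Component, ((G.spanning A).component C).f = 1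

/-- The delta-matroid `D(G)`: feasible sets are the edge sets of the spanning quasi-trees. -/
def D (G : RibbonGraph V E) : SetSystem E where
  feasible := {A | G.IsSpanningQuasiTree A}

/-- `D_{≤ n}(G)`: feasible sets are the `A ⊆ E` with `f(A) ≤ k(G) + n`. -/
def DLe (G : RibbonGraph V E) (n : ℕ) : SetSystem E where
  feasible := {A | (G.spanning A).f ≤ G.k + n}

/-- `D_n(G)`: feasible sets are the `A ⊆ E` with `f(A) = k(G) + n`. -/
def DEq (G : RibbonGraph V E) (n : ℕ) : SetSystem E where
  feasible := {A | (G.spanning A).f = G.k + n}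

end RibbonGraph

/-! The boundary curves of `(V, A)` through corners are the orbits of two fixed-point-free
involutions on corners: `arcInv`, independent of `A`, and `edgeInv A`. Toggling one edge `e` only
recouples the four corners of `e`. This changes the number of orbits by at most one
(`card_le_card_add_one`), and lowers it if the two old pairs lie on different curves
(`card_lt_card`, a parity argument that needs no orientability).

Hence, if no single toggle lowers `f(A)`, all corners of each edge share a curve. So do all corners
at a vertex, and then all corners in a component of `G`, whence `f(A) ≤ k(G)`
(`f_le_k_of_forall_le`). Since `k(G) ≤ k(V, A) ≤ f(A)`, the spanning quasi-trees are exactly the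
sets with `f(A) = k(G)`. Thus `f(A) - k(G)` is the distance, in toggles, from `A` to the nearest
quasi-tree, which gives the spread and toggle descriptions. Non-emptiness is a discrete intermediate
value argument, descending from the edge set of the given subgraph. -/

/-! ### Orbits of pairs of fixed-point-free involutions -/

section Involutions

variable {α : Type*}

/-- A finite set preserved by a fixed-point-free involution has even cardinality. -/
theorem Finset.even_card_of_involutive {s : Finset α} {g : α → α} (hg : Function.Involutive g)
    (hfix : ∀ x, g x ≠ x) (hs : ∀ x ∈ s, g x ∈ s) : Even s.card := by
  have h : ∑ _x ∈ s, (1 : ZMod 2) = 0 :=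
    Finset.sum_involution (fun x _ => g x) (fun _ _ => by decide) (fun x _ _ => hfix x)
      (fun x hx => hs x hx) (fun x _ => hg x)
  rw [Finset.sum_const, nsmul_eq_mul, mul_one] at h
  exact (ZMod.natCast_eq_zero_iff_even).1 h

/-- The orbits of the group generated by two involutions. -/
def JointOrbit (σ τ : α → α) : Type _ := Quot (fun x y => y = σ x ∨ y = τ x)

namespace JointOrbit

/-- The orbit of an element. -/
def mk (σ τ : α → α) (x : α) : JointOrbit σ τ := Quot.mk _ x

instance [Finite α] (σ τ : α → α) : Finite (JointOrbit σ τ) :=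
  inferInstanceAs (Finite (Quot _))

variable {σ τ τ' : α → α}

theorem mk_left (x : α) : mk σ τ (σ x) = mk σ τ x :=
  Eq.symm (Quot.sound (r := fun x y => y = σ x ∨ y = τ x) (Or.inl rfl))

theorem mk_right (x : α) : mk σ τ (τ x) = mk σ τ x :=
  Eq.symm (Quot.sound (r := fun x y => y = σ x ∨ y = τ x) (Or.inr rfl))

theorem mk_surjective : Function.Surjective (mk σ τ) := Quot.mk_surjective

/-- Lifting a function that is constant on orbits. -/
def lift {β : Type*} (φ : α → β) (hσ : ∀ x, φ (σ x) = φ x) (hτ : ∀ x, φ (τ x) = φ x) :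
    JointOrbit σ τ → β :=
  Quot.lift φ (by
    rintro x y (rfl | rfl)
    · exact (hσ x).symm
    · exact (hτ x).symm)

theorem lift_mk {β : Type*} (φ : α → β) (hσ : ∀ x, φ (σ x) = φ x) (hτ : ∀ x, φ (τ x) = φ x)
    (x : α) : lift φ hσ hτ (mk σ τ x) = φ x := rfl

/-- Recoupling two pairs of a matching changes the number of orbits by at most one. -/
theorem card_le_card_add_one [Finite α] {a c : α}
    (hτ' : Function.Involutive τ') (ha : τ' a = c) (hb : τ' (τ a) = τ c)
    (hne : ∀ x, x ≠ a → x ≠ τ a → x ≠ c → x ≠ τ c → τ' x = τ x) :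
    Nat.card (JointOrbit σ τ) ≤ Nat.card (JointOrbit σ τ') + 1 := by
  classical
  -- `g` merges the orbit of `c` into that of `a`. After this merging all four recoupled points
  -- agree, so the class is constant on `τ'`-orbits, and only the orbit of `c` can be missed.
  let g : JointOrbit σ τ → JointOrbit σ τ := fun q => if q = mk σ τ c then mk σ τ a else q
  have hg : ∀ q, q = mk σ τ a ∨ q = mk σ τ c → g q = mk σ τ a := by
    rintro q (rfl | rfl) <;> simp [g]
  have hstep : ∀ x, g (mk σ τ (τ' x)) = g (mk σ τ x) := by
    intro x
    by_cases h1 : x = a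
    · subst h1; rw [ha, hg _ (.inl rfl), hg _ (.inr rfl)]
    by_cases h2 : x = τ a
    · subst h2; rw [hb, mk_right, mk_right, hg _ (.inl rfl), hg _ (.inr rfl)]
    by_cases h3 : x = c
    · subst h3; rw [← ha, hτ' a, ha, hg _ (.inl rfl), hg _ (.inr rfl)]
    by_cases h4 : x = τ c
    · subst h4; rw [← hb, hτ', hb, mk_right, mk_right, hg _ (.inl rfl), hg _ (.inr rfl)]
    rw [hne x h1 h2 h3 h4, mk_right]
  let φ : JointOrbit σ τ' → JointOrbit σ τ :=
    lift (fun x => g (mk σ τ x)) (fun x => by rw [mk_left]) hstep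
  have huniv : (Set.univ : Set (JointOrbit σ τ)) ⊆ insert (mk σ τ c) (Set.range φ) := by
    intro q _
    by_cases hq : q = mk σ τ c
    · exact .inl hq
    · obtain ⟨x, rfl⟩ := mk_surjective q
      exact .inr ⟨mk σ τ' x, by simp [φ, lift_mk, g, hq]⟩
  calc Nat.card (JointOrbit σ τ) = (Set.univ : Set (JointOrbit σ τ)).ncard := by
        rw [Set.ncard_univ]
    _ ≤ (insert (mk σ τ c) (Set.range φ)).ncard := Set.ncard_le_ncard huniv (Set.toFinite _)
    _ ≤ (Set.range φ).ncard + 1 := Set.ncard_insert_le _ _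
    _ ≤ Nat.card (JointOrbit σ τ') + 1 := Nat.add_le_add_right (Finite.card_range_le φ) 1

/-- Recoupling two pairs of a matching that lie in different orbits merges these orbits. -/
theorem card_lt_card [Finite α] {a c : α} (hσ : Function.Involutive σ) (hσf : ∀ x, σ x ≠ x)
    (hτ : Function.Involutive τ) (hτf : ∀ x, τ x ≠ x)
    (ha : τ' a = c) (hb : τ' (τ a) = τ c)
    (hne : ∀ x, x ≠ a → x ≠ τ a → x ≠ c → x ≠ τ c → τ' x = τ x)
    (hac : mk σ τ a ≠ mk σ τ c) :
    Nat.card (JointOrbit σ τ') < Nat.card (JointOrbit σ τ) := by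
  classical
  -- The classes of `r` arise by cutting the pairs `{a, τ a}` and `{c, τ c}`; they map to both the
  -- old and the new orbits.
  let r : α → α → Prop := fun x y =>
    y = σ x ∨ (y = τ x ∧ x ≠ a ∧ x ≠ τ a ∧ x ≠ c ∧ x ≠ τ c)
  let toOld : Quot r → JointOrbit σ τ := Quot.lift (mk σ τ) (by
    rintro x y (rfl | ⟨rfl, -⟩)
    · exact (mk_left x).symm
    · exact (mk_right x).symm)
  let toNew : Quot r → JointOrbit σ τ' := Quot.lift (mk σ τ') (by
    rintro x y (rfl | ⟨rfl, h1, h2, h3, h4⟩)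
    · exact (mk_left x).symm
    · rw [← hne x h1 h2 h3 h4, mk_right])
  -- The cut orbit of `a` stays connected: if its class `K` missed `τ a`, then `σ` would pair up `K`
  -- while `τ` pairs up `K` without `a`, so `|K|` would be both even and odd.
  have hab : Quot.mk r a = Quot.mk r (τ a) := by
    by_contra hab
    have := Fintype.ofFinite α
    let K : Finset α := Finset.univ.filter fun x => Quot.mk r a = Quot.mk r x
    have hK : ∀ x, x ∈ K ↔ Quot.mk r a = Quot.mk r x := fun x => by simp [K]
    have hKσ : Even K.card := Finset.even_card_of_involutive hσ hσf fun x hx =>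
      (hK _).2 (((hK x).1 hx).trans (Quot.sound (.inl rfl)))
    have hKτ : Even (K.erase a).card := by
      refine Finset.even_card_of_involutive hτ hτf fun x hx => ?_
      obtain ⟨hxa, hxK⟩ := Finset.mem_erase.1 hx
      have hx' := (hK x).1 hxK
      have hxb : x ≠ τ a := by rintro rfl; exact hab hx'
      refine Finset.mem_erase.2 ⟨fun h => hxb (by rw [← h, hτ]), (hK _).2 (hx'.trans
        (Quot.sound (.inr ⟨rfl, hxa, hxb, ?_, ?_⟩)))⟩
      · rintro rfl; exact hac (congrArg toOld hx')
      · rintro rfl; exact hac ((congrArg toOld hx').trans (mk_right c))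
    have haK : a ∈ K := (hK a).2 rfl
    rw [← Finset.card_erase_add_one haK] at hKσ
    exact (Nat.even_add_one.1 hKσ) hKτ
  have hab' : mk σ τ' a = mk σ τ' (τ a) := congrArg toNew hab
  have hac' : mk σ τ' c = mk σ τ' a := by rw [← ha, mk_right]
  have hbd' : mk σ τ' (τ c) = mk σ τ' (τ a) := by rw [← hb, mk_right]
  -- All four points now lie in one new orbit, so old orbits map onto new ones, with those of `a`
  -- and `c` identified.
  let φ : JointOrbit σ τ → JointOrbit σ τ' := lift (mk σ τ') mk_left (by
    intro x
    by_cases h1 : x = a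
    · rw [h1, hab']
    by_cases h2 : x = τ a
    · rw [h2, hτ, hab']
    by_cases h3 : x = c
    · rw [h3, hbd', hac', hab']
    by_cases h4 : x = τ c
    · rw [h4, hτ, hbd', hac', hab']
    rw [← hne x h1 h2 h3 h4, mk_right])
  have hφ : Function.Surjective φ := fun q => by
    obtain ⟨x, rfl⟩ := mk_surjective q
    exact ⟨mk σ τ x, rfl⟩
  refine lt_of_le_of_ne (Nat.card_le_card_of_surjective φ hφ) fun h => hac ?_
  exact ((Nat.bijective_iff_surjective_and_card φ).2 ⟨hφ, h.symm⟩).1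
    (show mk σ τ' a = mk σ τ' c from hac'.symm)

end JointOrbit

end Involutions

/-! ### Boundary components of ribbon subgraphs -/

namespace RibbonGraph

variable {V E : Type*} {G : RibbonGraph V E}

theorem vert_rot (G : RibbonGraph V E) (h : E × Bool) : G.vert (G.rot h) = G.vert h :=
  ((G.vert_eq_iff h (G.rot h)).2 ⟨1, by simp⟩).symm

namespace Subgraph

/-- The boundary components of a ribbon subgraph. -/
def Boundary (H : G.Subgraph) : Type _ :=
  Quot (fun c d : H.Corner => H.BoundaryStep c.1 d.1) ⊕
    {v : V // v ∈ H.verts ∧ ∀ h, G.vert h ≠ v}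

instance [Finite E] (H : G.Subgraph) : Finite H.Corner := inferInstanceAs (Finite (Subtype _))

instance [Finite V] [Finite E] (H : G.Subgraph) : Finite H.Boundary :=
  inferInstanceAs (Finite (_ ⊕ _))

instance [Finite V] (H : G.Subgraph) : Finite H.Component := inferInstanceAs (Finite (Quot _))

theorem card_boundary [Finite V] [Finite E] (H : G.Subgraph) : Nat.card H.Boundary = H.f :=
  Nat.card_sum

/-- The connected component on which a boundary component lies. -/
def Boundary.toComponent {H : G.Subgraph} : H.Boundary → H.Component :=
  Sum.elim (Quot.lift (fun c => Quot.mk _ ⟨G.vert c.1.1, c.2⟩) (by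
      rintro ⟨c, hc⟩ ⟨d, hd⟩ (h : H.BoundaryStep c d)
      cases h with
      | arc h => exact congrArg (Quot.mk _) (Subtype.ext (G.vert_rot h).symm)
      | segment h he => rfl
      | side e i s he => exact Quot.sound ⟨e, he, i, rfl, rfl⟩))
    (fun v => Quot.mk _ ⟨v.1, v.2.1⟩)

theorem Boundary.toComponent_surjective (H : G.Subgraph) :
    Function.Surjective (Boundary.toComponent (H := H)) := by
  rintro ⟨v, hv⟩
  by_cases h : ∃ h, G.vert h = v
  · obtain ⟨h, rfl⟩ := h
    exact ⟨.inl (Quot.mk _ ⟨(h, false), hv⟩), rfl⟩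
  · exact ⟨.inr ⟨v, hv, not_exists.1 h⟩, rfl⟩

theorem k_le_f [Finite V] [Finite E] (H : G.Subgraph) : H.k ≤ H.f :=
  H.card_boundary ▸ Nat.card_le_card_of_surjective _ (Boundary.toComponent_surjective H)

/-- `H'` consists of some vertices of `H` together with all edges of `H` that meet them. -/
structure IsClosedIn (H' H : G.Subgraph) : Prop where
  verts_subset : H'.verts ⊆ H.verts
  mem_edges_iff : ∀ h : E × Bool, G.vert h ∈ H'.verts → (h.1 ∈ H'.edges ↔ h.1 ∈ H.edges)

theorem IsClosedIn.boundaryStep_iff {H' H : G.Subgraph} (hH : H'.IsClosedIn H)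
    {c d : (E × Bool) × Bool} (hc : G.vert c.1 ∈ H'.verts) :
    H'.BoundaryStep c d ↔ H.BoundaryStep c d := by
  constructor
  · intro h
    cases h with
    | arc h => exact .arc h
    | segment h he => exact .segment h (mt (hH.mem_edges_iff h hc).2 he)
    | side e i s he => exact .side e i s ((hH.mem_edges_iff (e, i) hc).1 he)
  · intro h
    cases h with
    | arc h => exact .arc h
    | segment h he => exact .segment h (mt (hH.mem_edges_iff h hc).1 he)
    | side e i s he => exact .side e i s ((hH.mem_edges_iff (e, i) hc).2 he)

theorem IsClosedIn.vert_mem_iff {H' H : G.Subgraph} (hH : H'.IsClosedIn H)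
    {c d : (E × Bool) × Bool} (h : H.BoundaryStep c d) :
    G.vert c.1 ∈ H'.verts ↔ G.vert d.1 ∈ H'.verts := by
  cases h with
  | arc h => exact iff_of_eq (congrArg (· ∈ H'.verts) (G.vert_rot h).symm)
  | segment h he => exact Iff.rfl
  | side e i s he =>
    exact ⟨fun h => H'.vert_mem e ((hH.mem_edges_iff (e, i) h).2 he) _,
      fun h => H'.vert_mem e ((hH.mem_edges_iff (e, !i) h).2 he) _⟩

/-- The boundary components of a closed part of `H` are boundary components of `H`. -/
def IsClosedIn.boundaryMap {H' H : G.Subgraph} (hH : H'.IsClosedIn H) :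
    H'.Boundary → H.Boundary :=
  Sum.map (Quot.map (fun c : H'.Corner => (⟨c.1, hH.verts_subset c.2⟩ : H.Corner))
      (fun c _ h => (hH.boundaryStep_iff c.2).1 h))
    (fun v => ⟨v.1, hH.verts_subset v.2.1, v.2.2⟩)

/-- Boundary steps of `H` never cross between corners on `H'` and corners off it, so sending the
latter to `none` gives a left inverse. -/
theorem IsClosedIn.boundaryMap_injective {H' H : G.Subgraph} (hH : H'.IsClosedIn H) :
    Function.Injective hH.boundaryMap := by
  classical
  refine Sum.map_injective.2 ⟨?_, fun v w h => Subtype.ext (congrArg (fun x => x.1) h)⟩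
  let g : Quot (fun c d : H.Corner => H.BoundaryStep c.1 d.1) →
      Option (Quot (fun c d : H'.Corner => H'.BoundaryStep c.1 d.1)) :=
    Quot.lift (fun c => if hc : G.vert c.1.1 ∈ H'.verts then some (Quot.mk _ ⟨c.1, hc⟩) else none)
      (by
        intro c d h
        by_cases hc : G.vert c.1.1 ∈ H'.verts
        · have hd := (hH.vert_mem_iff h).1 hc
          simp only [hc, hd, dif_pos]
          exact congrArg some (Quot.sound ((hH.boundaryStep_iff hc).2 h))
        · have hd := mt (hH.vert_mem_iff h).2 hc
          simp only [hc, hd, dif_neg, not_false_eq_true])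
  have hg : ∀ q, g (Quot.map (fun c : H'.Corner => (⟨c.1, hH.verts_subset c.2⟩ : H.Corner))
      (fun c _ h => (hH.boundaryStep_iff c.2).1 h) q) = some q := by
    rintro ⟨c⟩
    exact dif_pos c.2
  intro q q' h
  exact Option.some_injective _ (by rw [← hg q, ← hg q', h])

theorem isClosedIn_component (H : G.Subgraph) (C : H.Component) :
    (H.component C).IsClosedIn H where
  verts_subset := fun _ hv => hv.1
  mem_edges_iff := by
    rintro ⟨e, i⟩ ⟨hv, hC⟩
    refine ⟨fun h => h.1, fun he => ⟨he, ?_⟩⟩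
    cases i
    · exact hC
    · exact (Quot.sound ⟨e, he, false, rfl, rfl⟩ : (Quot.mk _ _ : H.Component) = _).trans hC

theorem toComponent_boundaryMap (H : G.Subgraph) (C : H.Component)
    (b : (H.component C).Boundary) :
    ((H.isClosedIn_component C).boundaryMap b).toComponent = C := by
  rcases b with ⟨⟨c, hc⟩⟩ | ⟨v, hv, -⟩
  · exact hc.2
  · exact hv.2

/-- The boundary components of `H` are those of its connected components. -/
theorem f_eq_sum [Finite V] [Finite E] (H : G.Subgraph) [Fintype H.Component] :
    H.f = ∑ C, (H.component C).f := by
  simp_rw [← card_boundary]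
  rw [← Nat.card_sigma]
  refine (Nat.card_congr (Equiv.ofBijective
    (fun x : Σ C, (H.component C).Boundary => (H.isClosedIn_component x.1).boundaryMap x.2)
    ⟨?_, ?_⟩)).symm
  · rintro ⟨C, b⟩ ⟨C', b'⟩ h
    obtain rfl : C = C' := by
      rw [← H.toComponent_boundaryMap C b, ← H.toComponent_boundaryMap C' b']
      exact congrArg _ h
    exact congrArg _ ((H.isClosedIn_component C).boundaryMap_injective h)
  · rintro (⟨⟨c, hc⟩⟩ | ⟨v, hv, hiso⟩)
    · exact ⟨⟨Quot.mk _ ⟨_, hc⟩, .inl (Quot.mk _ ⟨c, hc, rfl⟩)⟩, rfl⟩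
    · exact ⟨⟨Quot.mk _ ⟨v, hv⟩, .inr ⟨v, ⟨hv, rfl⟩, hiso⟩⟩, rfl⟩

theorem component_verts_nonempty (H : G.Subgraph) (C : H.Component) :
    (H.component C).verts.Nonempty := by
  obtain ⟨⟨v, hv⟩⟩ := C
  exact ⟨v, hv, rfl⟩

theorem one_le_f [Finite V] [Finite E] (H : G.Subgraph) (hH : H.verts.Nonempty) : 1 ≤ H.f := by
  obtain ⟨v, hv⟩ := hH
  have : Nonempty H.Component := ⟨Quot.mk _ ⟨v, hv⟩⟩
  exact (Nat.succ_le_of_lt Nat.card_pos).trans H.k_le_f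

/-- `f` is a sum over the components of terms that are each at least one. -/
theorem f_eq_k_iff [Finite V] [Finite E] (H : G.Subgraph) :
    H.f = H.k ↔ ∀ C, (H.component C).f = 1 := by
  have := Fintype.ofFinite H.Component
  have hk : H.k = ∑ _C : H.Component, 1 := by simp [k, Nat.card_eq_fintype_card]
  rw [H.f_eq_sum, hk, eq_comm,
    Finset.sum_eq_sum_iff_of_le fun C _ => one_le_f _ (H.component_verts_nonempty C)]
  exact ⟨fun h C => (h C (Finset.mem_univ C)).symm, fun h C _ => (h C).symm⟩

/-- Adding vertices without edges does not lower the number of boundary components. -/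
theorem f_le_f_spanning [Finite V] [Finite E] (H : G.Subgraph) :
    H.f ≤ (G.spanning H.edges).f := by
  have hH : H.IsClosedIn (G.spanning H.edges) := ⟨Set.subset_univ _, fun _ _ => Iff.rfl⟩
  rw [← card_boundary, ← card_boundary]
  exact Nat.card_le_card_of_injective _ hH.boundaryMap_injective

end Subgraph

theorem k_le_k_spanning [Finite V] (G : RibbonGraph V E) (A : Set E) :
    G.k ≤ (G.spanning A).k := by
  refine Nat.card_le_card_of_surjective
    (Quot.map id fun u v => ?_ : (G.spanning A).Component → (G.spanning Set.univ).Component) ?_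
  · rintro ⟨e, -, i, h⟩
    exact ⟨e, Set.mem_univ e, i, h⟩
  · rintro ⟨v⟩
    exact ⟨Quot.mk _ v, rfl⟩

theorem k_le_f_spanning [Finite V] [Finite E] (G : RibbonGraph V E) (A : Set E) :
    G.k ≤ (G.spanning A).f :=
  (G.k_le_k_spanning A).trans (Subgraph.k_le_f _)

/-- In `k(G) ≤ k(V, A) ≤ f(A)`, equality of the extremes forces both equalities, which are the two
defining conditions. -/
theorem isSpanningQuasiTree_iff [Finite V] [Finite E] (G : RibbonGraph V E) (A : Set E) :
    G.IsSpanningQuasiTree A ↔ (G.spanning A).f = G.k := by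
  rw [IsSpanningQuasiTree, ← Subgraph.f_eq_k_iff]
  have h1 := G.k_le_k_spanning A
  have h2 := (G.spanning A).k_le_f
  omega

/-! ### Changing one edge of a spanning ribbon subgraph -/

/-- The other end of the arc of a vertex disc that starts or ends at a corner. -/
def arcInv (G : RibbonGraph V E) : (E × Bool) × Bool → (E × Bool) × Bool
  | (h, true) => (G.rot h, false)
  | (h, false) => (G.rot.symm h, true)

open Classical in
/-- The other end of the piece of the boundary of `(V, A)` at a corner that is not an arc of a
vertex disc: a side of an edge in `A`, or a segment of an edge outside `A`. -/
noncomputable def edgeInv (G : RibbonGraph V E) (A : Set E) (c : (E × Bool) × Bool) :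
    (E × Bool) × Bool :=
  if c.1.1 ∈ A then ((c.1.1, !c.1.2), if G.twisted c.1.1 then c.2 else !c.2) else (c.1, !c.2)

theorem arcInv_involutive (G : RibbonGraph V E) : Function.Involutive G.arcInv := by
  rintro ⟨h, _ | _⟩ <;> simp [arcInv]

theorem arcInv_ne (G : RibbonGraph V E) (c : (E × Bool) × Bool) : G.arcInv c ≠ c := by
  rcases c with ⟨h, _ | _⟩ <;> simp [arcInv]

theorem edgeInv_of_mem {A : Set E} {e : E} (he : e ∈ A) (i s : Bool) :
    G.edgeInv A ((e, i), s) = ((e, !i), if G.twisted e then s else !s) := if_pos he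

theorem edgeInv_of_notMem {A : Set E} {e : E} (he : e ∉ A) (i s : Bool) :
    G.edgeInv A ((e, i), s) = ((e, i), !s) := if_neg he

theorem edgeInv_involutive (G : RibbonGraph V E) (A : Set E) :
    Function.Involutive (G.edgeInv A) := by
  rintro ⟨⟨e, i⟩, s⟩
  by_cases he : e ∈ A
  · cases ht : G.twisted e <;> simp [edgeInv_of_mem he, ht]
  · simp [edgeInv_of_notMem he]

theorem edgeInv_ne (G : RibbonGraph V E) (A : Set E) (c : (E × Bool) × Bool) :
    G.edgeInv A c ≠ c := by
  rcases c with ⟨⟨e, i⟩, s⟩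
  by_cases he : e ∈ A
  · simp [edgeInv_of_mem he]
  · simp [edgeInv_of_notMem he]

/-- Makes toggling an edge a recoupling: with `c = τ' a`, commutation gives `τ' (τ a) = τ c`. -/
theorem edgeInv_comm (G : RibbonGraph V E) (A B : Set E) (c : (E × Bool) × Bool) :
    G.edgeInv A (G.edgeInv B c) = G.edgeInv B (G.edgeInv A c) := by
  rcases c with ⟨⟨e, i⟩, s⟩
  by_cases hA : e ∈ A <;> by_cases hB : e ∈ B <;> cases ht : G.twisted e <;>
    simp [edgeInv, hA, hB, ht]

theorem edgeInv_congr {A B : Set E} {c : (E × Bool) × Bool} (h : c.1.1 ∈ A ↔ c.1.1 ∈ B) :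
    G.edgeInv A c = G.edgeInv B c := by
  by_cases hA : c.1.1 ∈ A
  · rw [edgeInv, edgeInv, if_pos hA, if_pos (h.1 hA)]
  · rw [edgeInv, edgeInv, if_neg hA, if_neg (mt h.2 hA)]

/-- The four corners of an edge are obtained from one of them by the pairings for two sets
that differ in this edge. -/
theorem eq_of_edgeInv {A B : Set E} {e : E} (hAB : e ∈ A ↔ e ∉ B) (i s : Bool)
    {c : (E × Bool) × Bool} (hc : c.1.1 = e) :
    c = ((e, i), s) ∨ c = G.edgeInv A ((e, i), s) ∨ c = G.edgeInv B ((e, i), s) ∨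
      c = G.edgeInv A (G.edgeInv B ((e, i), s)) := by
  rcases c with ⟨⟨e', j⟩, t⟩
  obtain rfl : e' = e := hc
  by_cases hB : e' ∈ B <;> cases ht : G.twisted e' <;>
    cases i <;> cases s <;> cases j <;> cases t <;>
    simp [edgeInv, hAB, hB, ht]

/-- The closed boundary curves of `(V, A)` that pass through corners. -/
abbrev BoundaryCurve (G : RibbonGraph V E) (A : Set E) : Type _ :=
  JointOrbit G.arcInv (G.edgeInv A)

/-- The closed boundary curve of `(V, A)` through a corner. -/
noncomputable abbrev curve (G : RibbonGraph V E) (A : Set E) (c : (E × Bool) × Bool) : G.BoundaryCurve A :=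
  JointOrbit.mk _ _ c

theorem boundaryStep_sound {A : Set E} {c d : (E × Bool) × Bool}
    (h : (G.spanning A).BoundaryStep c d) : G.curve A c = G.curve A d := by
  cases h with
  | arc h => exact (JointOrbit.mk_left (σ := G.arcInv) (τ := G.edgeInv A) (h, true)).symm
  | segment h he =>
    rw [curve, ← JointOrbit.mk_right, edgeInv_of_notMem (A := A) he]; rfl
  | side e i s he =>
    rw [curve, ← JointOrbit.mk_right, edgeInv_of_mem (A := A) he]

/-- The two descriptions of the boundary curves agree. -/
noncomputable def boundaryCurveEquiv (G : RibbonGraph V E) (A : Set E) :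
    Quot (fun c d : (G.spanning A).Corner => (G.spanning A).BoundaryStep c.1 d.1) ≃
      G.BoundaryCurve A where
  toFun := Quot.lift (fun c => G.curve A c.1) fun _ _ => boundaryStep_sound
  invFun := JointOrbit.lift (fun c => Quot.mk _ ⟨c, Set.mem_univ _⟩)
    (by
      rintro ⟨h, _ | _⟩
      · refine Quot.sound ?_
        have := Subgraph.BoundaryStep.arc (H := G.spanning A) (G.rot.symm h)
        rwa [Equiv.apply_symm_apply] at this
      · exact (Quot.sound (.arc h)).symm)
    (by
      rintro ⟨⟨e, i⟩, s⟩
      by_cases he : e ∈ A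
      · refine (Quot.sound ?_).symm
        show Subgraph.BoundaryStep _ _ (G.edgeInv A _)
        rw [edgeInv_of_mem he]
        exact .side e i s he
      · cases s
        · refine (Quot.sound ?_).symm
          show Subgraph.BoundaryStep _ _ (G.edgeInv A _)
          rw [edgeInv_of_notMem he]
          exact .segment (e, i) he
        · refine Quot.sound ?_
          show Subgraph.BoundaryStep _ (G.edgeInv A _) _
          rw [edgeInv_of_notMem he]
          exact .segment (e, i) he)
  left_inv := by rintro ⟨c⟩; rfl
  right_inv := by rintro ⟨c⟩; rfl

/-- The number of isolated vertices does not depend on the edge set. -/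
theorem f_spanning (G : RibbonGraph V E) (A : Set E) :
    (G.spanning A).f =
      Nat.card (G.BoundaryCurve A) + Nat.card {v : V // ∀ h, G.vert h ≠ v} := by
  rw [Subgraph.f, Nat.card_congr (G.boundaryCurveEquiv A)]
  congr 1
  exact Nat.card_congr (Equiv.subtypeEquivRight fun v => and_iff_right (Set.mem_univ v))

theorem mem_symmDiff_singleton_self (A : Set E) (e : E) : e ∈ A ∆ {e} ↔ e ∉ A := by
  simp [Set.mem_symmDiff]

theorem mem_symmDiff_singleton_of_ne (A : Set E) {e x : E} (h : x ≠ e) :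
    x ∈ A ∆ {e} ↔ x ∈ A := by
  simp [Set.mem_symmDiff, h]

theorem edgeInv_symmDiff_eq (A : Set E) (e : E) (i s : Bool) (c : (E × Bool) × Bool)
    (h1 : c ≠ ((e, i), s)) (h2 : c ≠ G.edgeInv A ((e, i), s))
    (h3 : c ≠ G.edgeInv (A ∆ {e}) ((e, i), s))
    (h4 : c ≠ G.edgeInv A (G.edgeInv (A ∆ {e}) ((e, i), s))) :
    G.edgeInv (A ∆ {e}) c = G.edgeInv A c := by
  refine edgeInv_congr (mem_symmDiff_singleton_of_ne A fun hc => ?_)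
  have hAB : e ∈ A ↔ e ∉ A ∆ {e} := by rw [mem_symmDiff_singleton_self, not_not]
  rcases eq_of_edgeInv (G := G) hAB i s hc with h | h | h | h
  exacts [h1 h, h2 h, h3 h, h4 h]

theorem f_le_f_symmDiff_add_one [Finite E] (G : RibbonGraph V E) (A : Set E) (e : E) :
    (G.spanning A).f ≤ (G.spanning (A ∆ {e})).f + 1 := by
  rw [f_spanning, f_spanning, add_right_comm]
  exact Nat.add_le_add_right (JointOrbit.card_le_card_add_one (a := ((e, false), false))
    (G.edgeInv_involutive _) rfl (G.edgeInv_comm _ _ _)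
    (edgeInv_symmDiff_eq A e false false)) _

theorem f_symmDiff_le_f_add_one [Finite E] (G : RibbonGraph V E) (A : Set E) (e : E) :
    (G.spanning (A ∆ {e})).f ≤ (G.spanning A).f + 1 := by
  simpa using G.f_le_f_symmDiff_add_one (A ∆ {e}) e

theorem f_symmDiff_lt [Finite E] (A : Set E) (e : E) (i s : Bool)
    (h : G.curve A ((e, i), s) ≠ G.curve A (G.edgeInv (A ∆ {e}) ((e, i), s))) :
    (G.spanning (A ∆ {e})).f < (G.spanning A).f := by
  rw [f_spanning, f_spanning]
  exact Nat.add_lt_add_right (JointOrbit.card_lt_card G.arcInv_involutive G.arcInv_ne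
    (G.edgeInv_involutive A) (G.edgeInv_ne A) rfl (G.edgeInv_comm _ _ _)
    (edgeInv_symmDiff_eq A e i s) h) _

/-- By minimality the pairing after toggling `e` also preserves the curve at corners of `e`;
together with `edgeInv A` it reaches all four of them. -/
theorem curve_eq_of_edge_eq [Finite E] {A : Set E}
    (hA : ∀ e, (G.spanning A).f ≤ (G.spanning (A ∆ {e})).f) (e : E) (i j s t : Bool) :
    G.curve A ((e, i), s) = G.curve A ((e, j), t) := by
  have hs : ∀ i s, G.curve A ((e, i), s) = G.curve A (G.edgeInv (A ∆ {e}) ((e, i), s)) :=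
    fun i s => by
      by_contra h
      exact (hA e).not_gt (f_symmDiff_lt A e i s h)
  have hAB : e ∈ A ↔ e ∉ A ∆ {e} := by rw [mem_symmDiff_singleton_self, not_not]
  rcases eq_of_edgeInv (G := G) hAB i s (c := ((e, j), t)) rfl with h | h | h | h <;> rw [h]
  · rw [curve, curve, JointOrbit.mk_right]
  · exact hs i s
  · rw [hs i s, curve, curve, JointOrbit.mk_right]

/-- An arc links each segment to its successor under `rot`, and the segments at a vertex form one
cycle of `rot`. -/
theorem curve_eq_of_vert_eq {A : Set E}
    (hA : ∀ e i j s t, G.curve A ((e, i), s) = G.curve A ((e, j), t))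
    {h h' : E × Bool} (hv : G.vert h = G.vert h') (s t : Bool) :
    G.curve A (h, s) = G.curve A (h', t) := by
  have hrot : ∀ g : E × Bool, G.curve A (G.rot g, false) = G.curve A (g, false) := fun g =>
    (JointOrbit.mk_left (σ := G.arcInv) (τ := G.edgeInv A) (g, true)).trans (hA _ _ _ _ _)
  have hzpow : ∀ (n : ℤ) (g : E × Bool),
      G.curve A ((G.rot ^ n) g, false) = G.curve A (g, false) := by
    intro n
    induction n with
    | zero => intro g; rfl
    | succ n ih => intro g; rw [zpow_add_one, Equiv.Perm.mul_apply, ih, hrot]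
    | pred n ih =>
      intro g
      rw [zpow_sub_one, Equiv.Perm.mul_apply, ih, ← hrot, ← Equiv.Perm.mul_apply, mul_inv_cancel,
        Equiv.Perm.one_apply]
  obtain ⟨n, rfl⟩ := (G.vert_eq_iff h h').1 hv
  exact ((hA _ _ _ _ _).trans (hzpow n h).symm).trans (hA _ _ _ _ _)

/-- If no change of a single edge lowers the number of boundary components, then there is one
boundary component for every connected component of `G`. -/
theorem f_le_k_of_forall_le [Finite V] [Finite E] {A : Set E}
    (hA : ∀ e, (G.spanning A).f ≤ (G.spanning (A ∆ {e})).f) : (G.spanning A).f ≤ G.k := by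
  classical
  have hedge := curve_eq_of_edge_eq hA
  let β := G.BoundaryCurve A ⊕ {v : V // ∀ h, G.vert h ≠ v}
  -- The chosen segment is immaterial, since all corners at a vertex share a curve; an isolated
  -- vertex stands for its own boundary circle.
  let m : V → β := fun v =>
    if h : ∃ h, G.vert h = v then .inl (G.curve A (h.choose, false))
    else .inr ⟨v, not_exists.1 h⟩
  have hm : ∀ h s, m (G.vert h) = .inl (G.curve A (h, s)) := by
    intro h s
    have hex : ∃ h', G.vert h' = G.vert h := ⟨h, rfl⟩
    simp only [m, dif_pos hex]
    exact congrArg Sum.inl (curve_eq_of_vert_eq hedge hex.choose_spec _ _)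
  let φ : (G.spanning Set.univ).Component → β := Quot.lift (fun v => m v.1) (by
    rintro ⟨u, hu⟩ ⟨v, hv⟩ ⟨e, -, i, rfl, rfl⟩
    show m _ = m _
    rw [hm _ false, hm _ false, hedge])
  have hφ : Function.Surjective φ := by
    rintro (q | ⟨v, hv⟩)
    · obtain ⟨⟨h, s⟩, rfl⟩ := JointOrbit.mk_surjective q
      exact ⟨Quot.mk _ ⟨G.vert h, Set.mem_univ _⟩, hm h s⟩
    · exact ⟨Quot.mk _ ⟨v, Set.mem_univ _⟩, dif_neg (not_exists.2 hv)⟩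
  rw [f_spanning, ← Nat.card_sum]
  exact Nat.card_le_card_of_surjective φ hφ

theorem exists_f_symmDiff_lt [Finite V] [Finite E] {A : Set E} (hA : G.k < (G.spanning A).f) :
    ∃ e, (G.spanning (A ∆ {e})).f < (G.spanning A).f := by
  by_contra! h
  exact (f_le_k_of_forall_le h).not_gt hA

/-! ### Spreads and toggles -/

theorem f_symmDiff_le [Finite E] (G : RibbonGraph V E) (F A : Set E) :
    (G.spanning (F ∆ A)).f ≤ (G.spanning F).f + A.ncard := by
  induction A, A.toFinite using Set.Finite.induction_on with
  | empty => rw [← Set.bot_eq_empty, symmDiff_bot]; exact Nat.le_add_right _ _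
  | @insert a s ha hs ih =>
    have h : F ∆ insert a s = (F ∆ s) ∆ {a} := by
      rw [symmDiff_assoc]
      congr 1
      ext x
      by_cases hx : x = a <;> simp [Set.mem_symmDiff, hx, ha]
    rw [h, Set.ncard_insert_of_notMem ha hs]
    have := G.f_symmDiff_le_f_add_one (F ∆ s) a
    omega

/-- Greedy descent: as long as `f` exceeds `k(G)`, some toggle lowers it, so at most `n` toggles
reach a quasi-tree. -/
theorem exists_isSpanningQuasiTree_symmDiff [Finite V] [Finite E] (G : RibbonGraph V E) (n : ℕ) :
    ∀ A : Set E, (G.spanning A).f ≤ G.k + n →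
      ∃ F, G.IsSpanningQuasiTree F ∧ ∃ X : Set E, X.ncard ≤ n ∧ A = F ∆ X := by
  induction n with
  | zero =>
    intro A hA
    exact ⟨A, (G.isSpanningQuasiTree_iff A).2 (le_antisymm hA (G.k_le_f_spanning A)), ∅,
      by simp, (symmDiff_bot A).symm⟩
  | succ n ih =>
    intro A hA
    by_cases hlt : G.k < (G.spanning A).f
    · obtain ⟨e, he⟩ := exists_f_symmDiff_lt hlt
      obtain ⟨F, hF, X, hX, h⟩ := ih (A ∆ {e}) (by omega)
      refine ⟨F, hF, X ∆ {e}, ?_, ?_⟩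
      · refine (Set.ncard_le_ncard (t := insert e X) ?_ (Set.toFinite _)).trans
          ((Set.ncard_insert_le e X).trans (Nat.add_le_add_right hX 1))
        rintro x (⟨hx, -⟩ | ⟨hx, -⟩)
        exacts [.inr hx, .inl hx]
      · rw [← symmDiff_assoc, ← h, symmDiff_symmDiff_cancel_right]
    · obtain ⟨F, hF, X, hX, h⟩ := ih A (by omega)
      exact ⟨F, hF, X, by omega, h⟩

theorem mem_spread_iff [Finite V] [Finite E] (G : RibbonGraph V E) (n : ℕ) (A : Set E) :
    A ∈ (G.D.spread n).feasible ↔ (G.spanning A).f ≤ G.k + n := by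
  constructor
  · rintro ⟨F, hF, X, hX, rfl⟩
    have h1 := G.f_symmDiff_le F X
    have h2 := (G.isSpanningQuasiTree_iff F).1 hF
    omega
  · intro hA
    obtain ⟨F, hF, X, hX, h⟩ := G.exists_isSpanningQuasiTree_symmDiff n A hA
    exact ⟨F, hF, X, by exact_mod_cast hX, h⟩

theorem mem_toggle_iff [Finite V] [Finite E] (G : RibbonGraph V E) (n : ℕ) (A : Set E) :
    A ∈ (G.D.toggle n).feasible ↔ (G.spanning A).f = G.k + n := by
  change A ∈ (G.D.spread n).feasible ∧ A ∉ (G.D.spread (n - 1)).feasible ↔ _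
  rw [mem_spread_iff]
  cases n with
  | zero =>
    have h := G.k_le_f_spanning A
    -- The spread of index `-1` is empty because cardinalities are non-negative.
    have hempty : A ∉ (G.D.spread ((0 : ℕ) - 1)).feasible := by
      rintro ⟨F, -, X, hX, -⟩
      omega
    simp only [hempty, not_false_eq_true, and_true]
    omega
  | succ n =>
    rw [show ((n + 1 : ℕ) : ℤ) - 1 = n by push_cast; ring, mem_spread_iff]
    omega

/-- All numbers of boundary components between the smallest and a given one occur. -/
theorem exists_f_eq [Finite V] [Finite E] (G : RibbonGraph V E) {m : ℕ} (hm : G.k ≤ m)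
    {A : Set E} (hA : m ≤ (G.spanning A).f) : ∃ B, (G.spanning B).f = m := by
  induction hd : (G.spanning A).f - m generalizing A with
  | zero => exact ⟨A, by omega⟩
  | succ d ih =>
    obtain ⟨e, he⟩ := exists_f_symmDiff_lt (G := G) (A := A) (by omega)
    -- The lowering toggle drops `f` by exactly one, so the descent cannot skip `m`.
    have := G.f_le_f_symmDiff_add_one A e
    exact ih (A := A ∆ {e}) (by omega) (by omega)

end RibbonGraph

theorem mainTheorem5 {V E : Type*} [Finite V] [Finite E] (G : RibbonGraph V E) (n : ℕ) :
    G.DLe n = G.D.spread n ∧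
    ((∃ H : G.Subgraph, H.f = n + G.k) →
      (G.D.toggle n).feasible.Nonempty ∧ G.DEq n = G.D.toggle n) := by
  refine ⟨SetSystem.ext (Set.ext fun A => (G.mem_spread_iff n A).symm), ?_⟩
  rintro ⟨H, hH⟩
  refine ⟨?_, SetSystem.ext (Set.ext fun A => (G.mem_toggle_iff n A).symm)⟩
  -- Restoring the missing vertices to `H` does not lower its boundary count, so the descent can
  -- start at `H.edges`.
  obtain ⟨B, hB⟩ := G.exists_f_eq (m := G.k + n) (Nat.le_add_right _ _)
    (A := H.edges) (by rw [add_comm, ← hH]; exact H.f_le_f_spanning)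
  exact ⟨B, (G.mem_toggle_iff n B).2 hB⟩
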